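/- Let $X$ and $Y$ be locally compact Hausdorff spaces, let $C_0(X)$ and $C_0(Y)$ be the algebras of continuous complex-valued functions vanishing at infinity, with the supremum norm, and let $n\ge 1$ be an integer. Let $P : C_0(X)\to C_0(Y)$ be an $n$-homogeneous polynomial, i.e. $P(f)=L(f,\dots,f)$ for all $f\in C_0(X)$, where $L : C_0(X)\times\cdots\times C_0(X)\to C_0(Y)$ is a symmetric $n$-linear map over $\mathbb{C}$ (boundedness of $L$ is not assumed). Suppose that 1. $P$ is orthogonally additive: $P(f+g)=P(f)+P(g)$ for all $f,g\in C_0(X)$ with $fg=0$; 2. $P$ is an $n$-isometry on positive elements: $\|P(f)\|=\|f\|^n$ for every $f\in C_0(X)$ with $f\ge 0$ pointwise; 3. the range of $P$ is regular: for every closed set $Y_0\subseteq Y$ and every $y\in Y\setminus Y_0$ there is $f\in C_0(X)$ such that $P(f)=0$ on $Y_0$ and $P(f)(y)\neq 0$. Then there exist a continuous function $h : Y\to\mathbb{C}$ with $|h(y)|=1$ for all $y\in Y$ and a homeomorphism $\varphi$ from $Y$ onto $X$ such that $$P(f)(y)=h(y)\,f(\varphi(y))^n\qquad\text{for all } f\in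 C_0(X),\ y\in Y.$$ -/

import Mathlib

open scoped ZeroAtInfty

/-- `P : E → F` is an `n`-homogeneous polynomial: it is the restriction to the diagonal of a
symmetric `n`-linear map over `ℂ`. Continuity of the `n`-linear map is not required. -/
def IsHomogeneousPolynomial {E F : Type*} [AddCommGroup E] [Module ℂ E]
    [AddCommGroup F] [Module ℂ F] (n : ℕ) (P : E → F) : Prop :=
  ∃ L : MultilinearMap ℂ (fun _ : Fin n => E) F,
    (∀ (σ : Equiv.Perm (Fin n)) (v : Fin n → E), L (fun i => v (σ i)) = L v) ∧
      ∀ x : E, P x = L (fun _ => x)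

/-- `Φ` is orthogonally additive: `fg = gf = 0` implies `Φ (f + g) = Φ f + Φ g`. -/
def IsOrthogonallyAdditive {A B : Type*} [NonUnitalRing A] [NonUnitalRing B]
    (Φ : A → B) : Prop :=
  ∀ f g : A, f * g = 0 → g * f = 0 → Φ (f + g) = Φ f + Φ g

/-- The function `f` takes only nonnegative real values, that is, it lies in the positive
cone of the C*-algebra `C₀(X, ℂ)`. -/
def IsPositiveFunction {X : Type*} [TopologicalSpace X] (f : C₀(X, ℂ)) : Prop :=
  ∀ x : X, 0 ≤ (f x).re ∧ (f x).im = 0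

/-- `P` is an `n`-isometry on positive elements: `‖P f‖ = ‖f‖ ^ n` (supremum norms) for every
positive `f`. -/
def IsNIsometryOnPositive {X Y : Type*} [TopologicalSpace X] [TopologicalSpace Y]
    (n : ℕ) (P : C₀(X, ℂ) → C₀(Y, ℂ)) : Prop :=
  ∀ f : C₀(X, ℂ), IsPositiveFunction f → ‖P f‖ = ‖f‖ ^ n

/-- A set `F` of functions on `Y` is regular: every point outside a closed set is separated
from it by a member of `F` that vanishes on the closed set but not at the point. -/
def IsRegularSet {Y : Type*} [TopologicalSpace Y] (F : Set C₀(Y, ℂ)) : Prop :=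
  ∀ Y₀ : Set Y, IsClosed Y₀ → ∀ y : Y, y ∉ Y₀ →
    ∃ f ∈ F, (∀ z ∈ Y₀, f z = 0) ∧ f y ≠ 0

-- The norm condition on the positive cone and polarization make the symmetric form `L` bounded.
-- Orthogonal additivity makes `L` vanish as soon as two of its arguments have product zero, and a
-- bounded multilinear map with this property lets multipliers move from one slot to another
-- (`map_bsmul_eq`). Hence, if `e` is a local unit for `f`, meaning `f * e = f`, then `P f = L(f^n
-- e, e, ..., e)`, so `P` is locally a linear function of `f ^ n` (`exists_local_linearization`).
-- Positive functions with a local unit have positive `n`-th roots, so these linear maps are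
-- isometric on them (`linearization_positive`).
--
-- The rest is an argument of Banach–Stone type. Positive norm-one functions peaking at `x` add up
-- without loss of norm, so their images share a unimodular value `h` at some point `y`
-- (`exists_common_value`). Perturbing a peak function by a small function vanishing at `x` shows
-- that such functions are killed at `y`, whence `P f y = h * f x ^ n` (`exists_evaluation_point`).
-- The set of all such `y` is closed, and regularity of the range forces it to be `Y`; regularity
-- also makes `y ↦ x` injective and closed.

-- Polarization and orthogonal additivity

-- The terms of `S` and `insert i S` cancel in pairs.
open Finset in
theorem sum_neg_one_pow_card_smul_eq_zero {ι M : Type*} [Fintype ι] [DecidableEq ι]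
    [AddCommGroup M] (g : Finset ι → M) (i : ι)
    (hg : ∀ S, i ∉ S → g (insert i S) = g S) :
    ∑ S : Finset ι, (-1 : ℤ) ^ S.card • g S = 0 := by
  have h : (univ : Finset (Finset ι)) = (insert i (univ.erase i)).powerset := by
    rw [insert_erase (mem_univ i), powerset_univ]
  rw [h, sum_powerset_insert (notMem_erase i _), ← sum_add_distrib]
  refine sum_eq_zero fun S hS => ?_
  have hi : i ∉ S := fun h => notMem_erase i _ (mem_powerset.1 hS h)
  rw [hg S hi, card_insert_of_notMem hi, pow_succ]
  simp

open Finset in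
/-- The polarization formula for a symmetric multilinear map. -/
theorem MultilinearMap.sum_neg_one_pow_card_smul_diagonal {ι E F : Type*} [Fintype ι]
    [DecidableEq ι] [AddCommGroup E] [Module ℂ E] [AddCommGroup F] [Module ℂ F]
    (L : MultilinearMap ℂ (fun _ : ι => E) F)
    (hL : ∀ (σ : Equiv.Perm ι) (v : ι → E), L (fun i => v (σ i)) = L v) (v : ι → E) :
    ∑ S : Finset ι, (-1 : ℤ) ^ S.card • L (fun _ => ∑ i ∈ S, v i) =
      ((-1 : ℤ) ^ Fintype.card ι * (Fintype.card ι).factorial) • L v := by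
  have h1 : ∀ S : Finset ι, L (fun _ => ∑ i ∈ S, v i) =
      ∑ r : ι → ι, if ∀ j, r j ∈ S then L (fun j => v (r j)) else 0 := by
    intro S
    rw [L.map_sum_finset (fun _ i => v i) (fun _ => S), ← sum_filter]
    refine sum_congr ?_ fun _ _ => rfl
    ext r
    simp [Fintype.mem_piFinset]
  simp_rw [h1, smul_sum]
  rw [sum_comm]
  -- A map `r` that misses an index `i` gives a summand insensitive to adding `i` to `S`, so it
  -- cancels; a bijective `r` sees only `S = univ`, and symmetry then yields `L v`.
  have h2 : ∀ r : ι → ι, ∑ S : Finset ι, (-1 : ℤ) ^ S.card •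
      (if ∀ j, r j ∈ S then L (fun j => v (r j)) else 0) =
      if Function.Bijective r then (-1 : ℤ) ^ Fintype.card ι • L v else 0 := by
    intro r
    split_ifs with hr
    · rw [sum_eq_single univ]
      · rw [if_pos (fun j => mem_univ _), card_univ]
        exact congrArg _ (hL (Equiv.ofBijective r hr) v)
      · intro S _ hS
        rw [if_neg, smul_zero]
        intro h
        refine hS (eq_univ_iff_forall.2 fun x => ?_)
        obtain ⟨j, rfl⟩ := hr.2 x
        exact h j
      · simp
    · have : ¬ Function.Surjective r := fun h => hr ⟨Finite.injective_iff_surjective.2 h, h⟩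
      simp only [Function.Surjective, not_forall, not_exists] at this
      obtain ⟨i, hi⟩ := this
      refine sum_neg_one_pow_card_smul_eq_zero _ i fun S _ => ?_
      have : (∀ j, r j ∈ insert i S) ↔ ∀ j, r j ∈ S :=
        forall_congr' fun j => by simp [hi j]
      simp only [this]
  rw [sum_congr rfl fun r _ => h2 r, ← sum_filter, sum_const, mul_comm, mul_smul]
  have h3 : #{r : ι → ι | Function.Bijective r} = (Fintype.card ι).factorial := by
    rw [← Fintype.card_perm, ← Fintype.card_subtype]
    exact Fintype.card_congr
      { toFun := fun r => Equiv.ofBijective r.1 r.2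
        invFun := fun σ => ⟨σ, σ.bijective⟩
        left_inv := fun _ => rfl
        right_inv := fun _ => Equiv.ext fun _ => rfl }
  rw [h3, natCast_zsmul]

theorem ZeroAtInftyContinuousMap.norm_le_iff {X : Type*} [TopologicalSpace X] {f : C₀(X, ℂ)}
    {C : ℝ} (hC : 0 ≤ C) : ‖f‖ ≤ C ↔ ∀ x, ‖f x‖ ≤ C := by
  rw [← ZeroAtInftyContinuousMap.norm_toBCF_eq_norm, BoundedContinuousFunction.norm_le hC]
  rfl

theorem ZeroAtInftyContinuousMap.norm_apply_le {X : Type*} [TopologicalSpace X] (f : C₀(X, ℂ))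
    (x : X) : ‖f x‖ ≤ ‖f‖ :=
  (ZeroAtInftyContinuousMap.norm_le_iff (norm_nonneg f)).1 le_rfl x

theorem ZeroAtInftyContinuousMap.sum_apply {X ι : Type*} [TopologicalSpace X] (s : Finset ι)
    (f : ι → C₀(X, ℂ)) (x : X) : (∑ i ∈ s, f i) x = ∑ i ∈ s, f i x :=
  map_sum (⟨⟨fun f : C₀(X, ℂ) => f x, rfl⟩, fun _ _ => rfl⟩ : C₀(X, ℂ) →+ ℂ) f s

-- Additivity splits each diagonal value in the polarization formula into a part from `A` and a part
-- from its complement. The first ignores whether `b ∈ S` and the second whether `a ∈ S`, so both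
-- alternating sums vanish.
open Finset in
theorem map_eq_zero_of_orthogonal_compl {X ι F : Type*} [TopologicalSpace X] [Fintype ι]
    [DecidableEq ι] [AddCommGroup F] [Module ℂ F]
    (L : MultilinearMap ℂ (fun _ : ι => C₀(X, ℂ)) F)
    (hL : ∀ (σ : Equiv.Perm ι) (v : ι → C₀(X, ℂ)), L (fun i => v (σ i)) = L v)
    (hadd : ∀ f g : C₀(X, ℂ), f * g = 0 → L (fun _ => f + g) = L (fun _ => f) + L (fun _ => g))
    (v : ι → C₀(X, ℂ)) (A : Finset ι) {a b : ι} (ha : a ∈ A) (hb : b ∉ A)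
    (hv : ∀ i ∈ A, ∀ j ∉ A, v i * v j = 0) : L v = 0 := by
  have h1 : ∀ S : Finset ι, L (fun _ => ∑ i ∈ S, v i) =
      L (fun _ => ∑ i ∈ S with i ∈ A, v i) + L (fun _ => ∑ i ∈ S with i ∉ A, v i) := by
    intro S
    rw [← hadd, sum_filter_add_sum_filter_not]
    rw [sum_mul_sum]
    refine sum_eq_zero fun i hi => sum_eq_zero fun j hj => ?_
    exact hv i (mem_filter.1 hi).2 j (mem_filter.1 hj).2
  have h2 := L.sum_neg_one_pow_card_smul_diagonal hL v
  rw [sum_congr rfl fun S _ => by rw [h1 S, smul_add], sum_add_distrib] at h2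
  rw [sum_neg_one_pow_card_smul_eq_zero _ b, sum_neg_one_pow_card_smul_eq_zero _ a, add_zero] at h2
  · have : ((((-1 : ℤ) ^ Fintype.card ι * (Fintype.card ι).factorial : ℤ) : ℂ)) • L v = 0 := by
      rw [Int.cast_smul_eq_zsmul]; exact h2.symm
    refine (smul_eq_zero.1 this).resolve_left ?_
    refine Int.cast_ne_zero.2 ?_
    exact mul_ne_zero (pow_ne_zero _ (by norm_num)) (by exact_mod_cast Nat.factorial_ne_zero _)
  · intro S _
    rw [filter_insert, if_neg (not_not.2 ha)]
  · intro S _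
    rw [filter_insert, if_neg hb]

-- Multipliers, cut-offs and positive parts

/-- Multiplication of a function vanishing at infinity by a bounded continuous function. -/
noncomputable def bsmul {X : Type*} [TopologicalSpace X] :
    (BoundedContinuousFunction X ℂ) →ₗ[ℂ] C₀(X, ℂ) →ₗ[ℂ] C₀(X, ℂ) :=
  LinearMap.mk₂ ℂ
    (fun a u => ⟨⟨fun x => a x * u x, a.continuous.mul (map_continuous u)⟩, by
      refine squeeze_zero_norm (a := fun x => ‖a‖ * ‖u x‖) (fun x => ?_) ?_
      · exact (norm_mul_le _ _).trans
          (mul_le_mul_of_nonneg_right (a.norm_coe_le_norm x) (norm_nonneg _))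
      · simpa using (zero_at_infty u).norm.const_mul ‖a‖⟩)
    (fun a b u => by ext x; exact add_mul _ _ _)
    (fun c a u => by ext x; exact mul_assoc _ _ _)
    (fun a u v => by ext x; exact mul_add _ _ _)
    (fun c a u => by ext x; exact mul_left_comm _ _ _)

@[simp]
theorem bsmul_apply {X : Type*} [TopologicalSpace X] (a : BoundedContinuousFunction X ℂ)
    (u : C₀(X, ℂ)) (x : X) : bsmul a u x = a x * u x := rfl

theorem norm_bsmul_le {X : Type*} [TopologicalSpace X] (a : BoundedContinuousFunction X ℂ)
    (u : C₀(X, ℂ)) : ‖bsmul a u‖ ≤ ‖a‖ * ‖u‖ := by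
  rw [ZeroAtInftyContinuousMap.norm_le_iff (by positivity)]
  intro x
  rw [bsmul_apply, norm_mul]
  exact mul_le_mul (a.norm_coe_le_norm x) (u.norm_apply_le x) (norm_nonneg _) (norm_nonneg _)

/-- A pair of cut-off functions along the level sets of a nonnegative function. -/
theorem exists_cutoff {X : Type*} [TopologicalSpace X] {s : X → ℝ} (hs : Continuous s)
    (h0 : ∀ x, 0 ≤ s x) {ε : ℝ} (hε : 0 < ε) :
    ∃ p q : X → ℝ, Continuous p ∧ Continuous q ∧ (∀ x, p x ∈ Set.Icc 0 1) ∧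
      (∀ x, q x ∈ Set.Icc 0 1) ∧ (∀ x, s x = 0 → q x = 0) ∧ (∀ x, p x = 0 ∨ q x = 1) ∧
      (∀ x, (1 - p x) * s x ≤ 2 * ε) ∧ (∀ x, q x ≤ s x / ε) := by
  -- `q` climbs from 0 to 1 while `s` runs over `[0, ε]`, and `p` only does so over `[ε, 2 * ε]`;
  -- hence `q = 1` wherever `p ≠ 0`.
  refine ⟨fun x => min 1 (max 0 (s x / ε - 1)), fun x => min 1 (s x / ε), by fun_prop,
    by fun_prop, fun x => ⟨by positivity, min_le_left _ _⟩, fun x => ⟨?_, min_le_left _ _⟩,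
    fun x hx => by simp [hx], fun x => ?_, fun x => ?_, fun x => min_le_right _ _⟩
  · exact le_min zero_le_one (div_nonneg (h0 x) hε.le)
  · rcases le_total (s x / ε) 1 with h | h
    · left
      beta_reduce
      rw [max_eq_left (by linarith), min_eq_right zero_le_one]
    · right
      exact min_eq_left h
  · rcases le_total (s x) (2 * ε) with h | h
    · have h1 : 0 ≤ min 1 (max 0 (s x / ε - 1)) := by positivity
      nlinarith [h0 x]
    · have : 1 ≤ s x / ε - 1 := by
        rw [le_sub_iff_add_le, le_div_iff₀ hε]; linarith
      beta_reduce
      rw [min_eq_left (le_max_of_le_right this), sub_self, zero_mul]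
      positivity

/-- A bounded continuous complex function from a continuous function with values in `[0, 1]`. -/
noncomputable def unitBCF {X : Type*} [TopologicalSpace X] (p : X → ℝ) (hp : Continuous p)
    (h : ∀ x, p x ∈ Set.Icc (0 : ℝ) 1) : BoundedContinuousFunction X ℂ :=
  BoundedContinuousFunction.ofNormedAddCommGroup (fun x => (p x : ℂ)) (by fun_prop) 1 fun x => by
    rw [Complex.norm_real, Real.norm_of_nonneg (h x).1]; exact (h x).2

@[simp]
theorem unitBCF_apply {X : Type*} [TopologicalSpace X] (p : X → ℝ) (hp : Continuous p)
    (h : ∀ x, p x ∈ Set.Icc (0 : ℝ) 1) (x : X) : unitBCF p hp h x = p x := rfl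

/-- A continuous function dominated by a function vanishing at infinity vanishes at infinity. -/
noncomputable def ofDominated {X : Type*} [TopologicalSpace X] (f : C₀(X, ℂ)) (C : ℝ) (g : X → ℂ)
    (hg : Continuous g) (h : ∀ x, ‖g x‖ ≤ C * ‖f x‖) : C₀(X, ℂ) :=
  ⟨⟨g, hg⟩, squeeze_zero_norm h (by simpa using (zero_at_infty f).norm.const_mul C)⟩

@[simp]
theorem ofDominated_apply {X : Type*} [TopologicalSpace X] (f : C₀(X, ℂ)) (C : ℝ) (g : X → ℂ)
    (hg : Continuous g) (h : ∀ x, ‖g x‖ ≤ C * ‖f x‖) (x : X) : ofDominated f C g hg h x = g x :=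
  rfl

theorem exists_positive_decomposition {X : Type*} [TopologicalSpace X] (f : C₀(X, ℂ)) :
    ∃ p : Fin 4 → C₀(X, ℂ), (∀ k, IsPositiveFunction (p k)) ∧ (∀ k x, ‖p k x‖ ≤ ‖f x‖) ∧
      f = ∑ k : Fin 4, Complex.I ^ (k : ℕ) • p k := by
  have key : ∀ φ : ℂ → ℝ, Continuous φ → (∀ z, |φ z| ≤ ‖z‖) → ∃ p : C₀(X, ℂ),
      IsPositiveFunction p ∧ (∀ x, ‖p x‖ ≤ ‖f x‖) ∧ ∀ x, p x = (max (φ (f x)) 0 : ℝ) := by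
    intro φ hφ hφ'
    have hf := map_continuous f
    have hb : ∀ x, ‖((max (φ (f x)) 0 : ℝ) : ℂ)‖ ≤ ‖f x‖ := by
      intro x
      rw [Complex.norm_real, Real.norm_of_nonneg (le_max_right _ _)]
      exact max_le ((le_abs_self _).trans (hφ' _)) (norm_nonneg _)
    refine ⟨ofDominated f 1 (fun x => (max (φ (f x)) 0 : ℝ)) (by fun_prop)
      fun x => (hb x).trans_eq (one_mul _).symm, fun x => ⟨?_, ?_⟩, fun x => ?_, fun x => rfl⟩
    · rw [ofDominated_apply, Complex.ofReal_re]
      exact le_max_right _ _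
    · rw [ofDominated_apply, Complex.ofReal_im]
    · rw [ofDominated_apply]
      exact hb x
  obtain ⟨p0, h0, h0', h0''⟩ := key Complex.re (by fun_prop) Complex.abs_re_le_norm
  obtain ⟨p1, h1, h1', h1''⟩ := key Complex.im (by fun_prop) Complex.abs_im_le_norm
  obtain ⟨p2, h2, h2', h2''⟩ := key (fun z => -z.re) (by fun_prop)
    (fun z => by rw [abs_neg]; exact Complex.abs_re_le_norm z)
  obtain ⟨p3, h3, h3', h3''⟩ := key (fun z => -z.im) (by fun_prop)
    (fun z => by rw [abs_neg]; exact Complex.abs_im_le_norm z)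
  refine ⟨![p0, p1, p2, p3], ?_, ?_, ?_⟩
  · intro k; fin_cases k <;> assumption
  · intro k; fin_cases k <;> assumption
  · ext x
    rw [ZeroAtInftyContinuousMap.sum_apply, Fin.sum_univ_four]
    simp only [ZeroAtInftyContinuousMap.smul_apply, Matrix.cons_val, h0'', h1'', h2'', h3'',
      smul_eq_mul]
    have e1 := max_zero_sub_max_neg_zero_eq_self (f x).re
    have e2 := max_zero_sub_max_neg_zero_eq_self (f x).im
    have hI : Complex.I ^ 3 = -Complex.I := by rw [pow_succ, Complex.I_sq]; ring
    rw [show ((0 : Fin 4) : ℕ) = 0 from rfl, show ((1 : Fin 4) : ℕ) = 1 from rfl,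
      show ((2 : Fin 4) : ℕ) = 2 from rfl, show ((3 : Fin 4) : ℕ) = 3 from rfl,
      pow_zero, pow_one, Complex.I_sq, hI]
    conv_lhs => rw [← Complex.re_add_im (f x), ← e1, ← e2]
    push_cast
    ring

-- Automatic boundedness and orthosymmetry

-- Partial sums of positive functions are positive, so polarization bounds `L` on positive
-- arguments; four positive parts per argument do the rest.
open Finset in
theorem exists_bound_of_bound_on_positive {X ι F : Type*} [TopologicalSpace X] [Fintype ι]
    [DecidableEq ι] [NormedAddCommGroup F] [NormedSpace ℂ F]
    (L : MultilinearMap ℂ (fun _ : ι => C₀(X, ℂ)) F)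
    (hL : ∀ (σ : Equiv.Perm ι) (v : ι → C₀(X, ℂ)), L (fun i => v (σ i)) = L v)
    (hpos : ∀ f : C₀(X, ℂ), IsPositiveFunction f → ‖L (fun _ => f)‖ ≤ ‖f‖ ^ Fintype.card ι) :
    ∃ C : ℝ, ∀ v, ‖L v‖ ≤ C * ∏ i, ‖v i‖ := by
  set n := Fintype.card ι
  -- For positive arguments of norm at most one, a subset sum has norm at most `n`, and there is one
  -- term per subset; the factor `n !` is at least 1 and is dropped.
  set C₁ : ℝ := ∑ _S : Finset ι, (n : ℝ) ^ n
  have hC₁ : 0 ≤ C₁ := by positivity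
  have h1 : ∀ v : ι → C₀(X, ℂ), (∀ i, IsPositiveFunction (v i)) → (∀ i, ‖v i‖ ≤ 1) →
      ‖L v‖ ≤ C₁ := by
    intro v hv hv1
    have h := congrArg norm (L.sum_neg_one_pow_card_smul_diagonal hL v)
    have hk : ‖L v‖ ≤ ‖((-1 : ℤ) ^ Fintype.card ι * (Fintype.card ι).factorial) • L v‖ := by
      rw [← Int.cast_smul_eq_zsmul ℝ, norm_smul]
      refine le_mul_of_one_le_left (norm_nonneg _) ?_
      push_cast
      rw [norm_mul, norm_pow, norm_neg, norm_one, one_pow, one_mul, Real.norm_natCast]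
      exact_mod_cast Nat.factorial_pos _
    refine hk.trans (h.symm.le.trans ((norm_sum_le _ _).trans (sum_le_sum fun S _ => ?_)))
    rw [← Int.cast_smul_eq_zsmul ℝ, norm_smul]
    push_cast
    rw [norm_pow, norm_neg, norm_one, one_pow, one_mul]
    refine (hpos _ fun x => ?_).trans (pow_le_pow_left₀ (norm_nonneg _) ?_ _)
    · rw [ZeroAtInftyContinuousMap.sum_apply, Complex.re_sum, Complex.im_sum]
      exact ⟨sum_nonneg fun i _ => (hv i x).1, sum_eq_zero fun i _ => (hv i x).2⟩
    · refine (norm_sum_le _ _).trans ((sum_le_sum fun i _ => hv1 i).trans ?_)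
      rw [sum_const, nsmul_eq_mul, mul_one]
      exact_mod_cast card_le_univ S
  have h2 : ∀ v : ι → C₀(X, ℂ), (∀ i, IsPositiveFunction (v i)) → ‖L v‖ ≤ C₁ * ∏ i, ‖v i‖ := by
    intro v hv
    have hu : v = fun i => (‖v i‖ : ℂ) • ((‖v i‖⁻¹ : ℝ) : ℂ) • v i := by
      funext i
      rcases eq_or_ne (v i) 0 with h | h
      · rw [h, smul_zero, smul_zero]
      · rw [smul_smul, ← Complex.ofReal_mul, mul_inv_cancel₀ (norm_ne_zero_iff.2 h),
          Complex.ofReal_one, one_smul]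
    conv_lhs => rw [hu]
    rw [L.map_smul_univ, norm_smul, norm_prod, mul_comm]
    simp_rw [Complex.norm_real, norm_norm]
    refine mul_le_mul_of_nonneg_right (h1 _ (fun i x => ?_) fun i => ?_) (by positivity)
    · rw [ZeroAtInftyContinuousMap.smul_apply, smul_eq_mul, Complex.re_ofReal_mul,
        Complex.im_ofReal_mul, (hv i x).2, mul_zero]
      exact ⟨mul_nonneg (by positivity) (hv i x).1, rfl⟩
    · rw [norm_smul, Complex.norm_real, norm_inv, norm_norm]
      exact inv_mul_le_one
  choose p hp hp' hsum using fun f : C₀(X, ℂ) => exists_positive_decomposition f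
  refine ⟨∑ _r : ι → Fin 4, C₁, fun v => ?_⟩
  have hv : v = fun i => ∑ k : Fin 4, Complex.I ^ (k : ℕ) • p (v i) k := funext fun i => hsum (v i)
  conv_lhs => rw [hv]
  rw [L.map_sum, sum_mul]
  refine (norm_sum_le _ _).trans (sum_le_sum fun r _ => ?_)
  rw [L.map_smul_univ, norm_smul, norm_prod]
  simp_rw [norm_pow, Complex.norm_I, one_pow, prod_const_one, one_mul]
  refine (h2 _ fun i => hp _ _).trans (mul_le_mul_of_nonneg_left ?_ hC₁)
  refine prod_le_prod (fun i _ => norm_nonneg _) fun i _ => ?_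
  rw [ZeroAtInftyContinuousMap.norm_le_iff (norm_nonneg _)]
  exact fun x => (hp' _ _ x).trans ((v i).norm_apply_le x)

open Finset in
/-- A continuous multilinear map on `C₀(X, ℂ)` which vanishes whenever its arguments split into two
mutually orthogonal families vanishes as soon as two of its arguments are orthogonal. -/
theorem map_eq_zero_of_orthogonal {X ι F : Type*} [TopologicalSpace X] [Fintype ι]
    [DecidableEq ι] [NormedAddCommGroup F] [NormedSpace ℂ F]
    (L : ContinuousMultilinearMap ℂ (fun _ : ι => C₀(X, ℂ)) F)
    (hL : ∀ (v : ι → C₀(X, ℂ)) (A : Finset ι) (a b : ι), a ∈ A → b ∉ A →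
      (∀ i ∈ A, ∀ j ∉ A, v i * v j = 0) → L v = 0)
    (v : ι → C₀(X, ℂ)) (A B : Finset ι) (hAB : Disjoint A B) {a b : ι} (ha : a ∈ A) (hb : b ∈ B)
    (hv : ∀ i ∈ A, ∀ j ∈ B, v i * v j = 0) : L v = 0 := by
  induction hm : #(A ∪ B)ᶜ generalizing v A B with
  | zero =>
    have hu : A ∪ B = univ := by rwa [card_eq_zero, compl_eq_empty_iff] at hm
    refine hL v A a b ha (disjoint_right.1 hAB hb) fun i hi j hj => hv i hi j ?_
    have : j ∈ A ∪ B := hu ▸ mem_univ j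
    exact (mem_union.1 this).resolve_left hj
  | succ m ih =>
    obtain ⟨c, hc⟩ : (A ∪ B)ᶜ.Nonempty := by rw [← card_pos, hm]; exact Nat.succ_pos m
    rw [mem_compl, mem_union, not_or] at hc
    have hclosed : IsClosed {w | L w = 0} := isClosed_eq L.cont continuous_const
    refine hclosed.closure_subset (Metric.mem_closure_iff.2 fun δ hδ => ?_)
    have hs : Continuous fun x => ∑ i ∈ A, ‖v i x‖ :=
      continuous_finsetSum _ fun i _ => (map_continuous (v i)).norm
    -- The functions indexed by `A` are shrunk slightly, by `ψ`, to make room for splitting `v c` as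
    -- `χ * v c + (1 - χ) * v c`. The first piece is orthogonal to the `B` family, so `c` joins `A`;
    -- the second is orthogonal to the shrunken `A` family, so `c` joins `B`. The error is at most
    -- `2 * (δ / 4) < δ`.
    obtain ⟨p, q, hp, hq, hp1, hq1, hq0, hpq, hps, -⟩ := exists_cutoff hs
      (fun x => sum_nonneg fun i _ => norm_nonneg _) (show (0 : ℝ) < δ / 4 by positivity)
    set ψ := unitBCF p hp hp1
    set χ := unitBCF q hq hq1
    set u : ι → C₀(X, ℂ) := fun i => if i ∈ A then bsmul ψ (v i) else v i
    have huA : ∀ i ∈ A, u i = bsmul ψ (v i) := fun i hi => if_pos hi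
    have huB : ∀ i, i ∉ A → u i = v i := fun i hi => if_neg hi
    refine ⟨u, ?_, ?_⟩
    · have hc' : u = Function.update u c (bsmul χ (v c) + bsmul (1 - χ) (v c)) := by
        rw [← LinearMap.add_apply, ← map_add, add_sub_cancel]
        have : bsmul 1 (v c) = u c := by
          rw [huB c hc.1]; ext x; simp
        rw [this, Function.update_eq_self]
      have hB : ∀ j ∈ B, ∀ x, v j x ≠ 0 → q x = 0 := by
        intro j hj x hx
        refine hq0 x (sum_eq_zero fun i hi => ?_)
        have := DFunLike.congr_fun (hv i hi j hj) x
        simpa [hx] using this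
      have huv : ∀ i ∈ A, ∀ j ∈ B, u i * u j = 0 := by
        intro i hi j hj
        rw [huA i hi, huB j (disjoint_right.1 hAB hj)]
        ext x
        have := DFunLike.congr_fun (hv i hi j hj) x
        rw [ZeroAtInftyContinuousMap.mul_apply] at this ⊢
        rw [bsmul_apply, mul_assoc, this]
        exact mul_zero _
      have hcard : #(insert c (A ∪ B))ᶜ = m := by
        rw [compl_insert, card_erase_of_mem (by simp [hc]), hm, Nat.add_sub_cancel]
      have hne : ∀ i, i ∈ A ∨ i ∈ B → i ≠ c := by
        rintro i hi rfl
        exact hi.elim hc.1 hc.2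
      show L u = 0
      rw [hc', L.map_update_add]
      have t1 : L (Function.update u c (bsmul χ (v c))) = 0 := by
        refine ih _ (insert c A) B ?_ (mem_insert_of_mem ha) hb ?_ ?_
        · rw [disjoint_insert_left]; exact ⟨hc.2, hAB⟩
        · intro i hi j hj
          rw [Function.update_of_ne (hne j (.inr hj))]
          rcases mem_insert.1 hi with rfl | hi
          · rw [Function.update_self, huB j (disjoint_right.1 hAB hj)]
            ext x
            by_cases hx : v j x = 0
            · simp [hx]
            · simp [χ, hB j hj x hx]
          · rw [Function.update_of_ne (hne i (.inl hi))]
            exact huv i hi j hj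
        · rw [insert_union, hcard]
      have t2 : L (Function.update u c (bsmul (1 - χ) (v c))) = 0 := by
        refine ih _ A (insert c B) ?_ ha (mem_insert_of_mem hb) ?_ ?_
        · rw [disjoint_insert_right]; exact ⟨hc.1, hAB⟩
        · intro i hi j hj
          rw [Function.update_of_ne (hne i (.inl hi))]
          rcases mem_insert.1 hj with rfl | hj
          · rw [Function.update_self, huA i hi]
            ext x
            rcases hpq x with h | h <;> simp [χ, ψ, h]
          · rw [Function.update_of_ne (hne j (.inr hj))]
            exact huv i hi j hj
        · rw [union_insert, hcard]
      rw [t1, t2, add_zero]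
    · refine (dist_pi_lt_iff hδ).2 fun i => ?_
      by_cases hi : i ∈ A
      · rw [huA i hi, dist_eq_norm]
        refine lt_of_le_of_lt ((ZeroAtInftyContinuousMap.norm_le_iff
          (show 0 ≤ 2 * (δ / 4) by positivity)).2 fun x => ?_) (by linarith)
        have e : (v i - bsmul ψ (v i)) x = ((1 - p x : ℝ) : ℂ) * v i x := by
          simp [ψ]; ring
        rw [e, norm_mul, Complex.norm_real, Real.norm_of_nonneg (sub_nonneg.2 (hp1 x).2)]
        refine le_trans (mul_le_mul_of_nonneg_left ?_ (sub_nonneg.2 (hp1 x).2)) (hps x)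
        exact single_le_sum (f := fun i => ‖v i x‖) (fun i _ => norm_nonneg _) hi
      · rw [huB i hi, dist_self]; exact hδ

-- Bilinear maps vanishing on zero products

-- Only the hats centred at `⌊t⌋` and `⌊t⌋ + 1` are nonzero at `t`. Taking `c = 1` gives a partition
-- of unity and `c k = k` recovers `t`.
open Finset in
theorem sum_hat_mul {t : ℝ} {K : ℤ} (ht : |t| < K) (c : ℤ → ℝ) :
    ∑ k ∈ Icc (-K) K, c k * max 0 (1 - |t - k|) =
      c ⌊t⌋ * (1 - Int.fract t) + c (⌊t⌋ + 1) * Int.fract t := by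
  have h0 := Int.fract_nonneg t
  have h1 := Int.fract_lt_one t
  have hf : Int.fract t = t - ⌊t⌋ := rfl
  have hK := abs_lt.1 ht
  have hsub : ({⌊t⌋, ⌊t⌋ + 1} : Finset ℤ) ⊆ Icc (-K) K := by
    have l1 : -K ≤ ⌊t⌋ := Int.le_floor.2 (by push_cast; linarith)
    have l2 : ⌊t⌋ < K := Int.floor_lt.2 hK.2
    intro k hk
    rw [mem_insert, mem_singleton] at hk
    rw [mem_Icc]
    omega
  rw [← sum_subset hsub, sum_pair (by simp)]
  · congr 2
    · rw [← hf, abs_of_nonneg h0, max_eq_right (by linarith)]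
    · rw [abs_of_nonpos (by push_cast; linarith), max_eq_right (by push_cast; linarith)]
      push_cast
      linarith
  · intro k _ hk
    rw [mem_insert, mem_singleton, not_or] at hk
    rw [max_eq_left, mul_zero]
    rcases lt_or_gt_of_ne hk.1 with h | h
    · have : (k : ℝ) + 1 ≤ ⌊t⌋ := by exact_mod_cast h
      rw [abs_of_nonneg (by linarith)]
      linarith
    · have : (⌊t⌋ : ℝ) + 2 ≤ k := by
        have : ⌊t⌋ + 2 ≤ k := by omega
        exact_mod_cast this
      rw [abs_of_nonpos (by linarith)]
      linarith

theorem BoundedContinuousFunction.finsetSum_apply {X ι : Type*} [TopologicalSpace X]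
    (s : Finset ι) (f : ι → BoundedContinuousFunction X ℂ) (x : X) :
    (∑ i ∈ s, f i) x = ∑ i ∈ s, f i x := by
  rw [BoundedContinuousFunction.coe_sum, Finset.sum_apply]

open Finset in
/-- A bounded bilinear map on bounded continuous functions which vanishes on pairs of functions
with zero product is balanced, for real-valued functions. -/
theorem zero_product_balanced_real {X F : Type*} [TopologicalSpace X] [NormedAddCommGroup F]
    [NormedSpace ℂ F]
    (β : BoundedContinuousFunction X ℂ →ₗ[ℂ] BoundedContinuousFunction X ℂ →ₗ[ℂ] F)
    {C : ℝ} (hC : ∀ a b, ‖β a b‖ ≤ C * ‖a‖ * ‖b‖) (hβ : ∀ a b, a * b = 0 → β a b = 0)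
    (f : BoundedContinuousFunction X ℂ) (g : X → ℝ) (hg : Continuous g) (hfg : ∀ x, f x = g x) :
    β f 1 = β 1 f := by
  have hC0 : 0 ≤ |C| := abs_nonneg C
  have key : ∀ N : ℕ, (N : ℝ) * ‖β f 1 - β 1 f‖ ≤ |C| := by
    intro N
    obtain ⟨K, hK⟩ := exists_int_gt (N * ‖f‖)
    have hgK : ∀ x, |N * g x| < K := by
      intro x
      refine lt_of_le_of_lt ?_ hK
      rw [abs_mul, Nat.abs_cast]
      refine mul_le_mul_of_nonneg_left ?_ (Nat.cast_nonneg _)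
      have := f.norm_coe_le_norm x
      rwa [hfg, Complex.norm_real] at this
    set e : ℤ → BoundedContinuousFunction X ℂ := fun k =>
      unitBCF (fun x => max 0 (1 - |N * g x - k|)) (by fun_prop)
        fun x => ⟨le_max_left _ _, max_le zero_le_one (by linarith [abs_nonneg (N * g x - k)])⟩
    have he : ∀ k x, e k x = ((max 0 (1 - |N * g x - k|) : ℝ) : ℂ) := fun _ _ => rfl
    have hcast : ∀ (c : ℤ → ℝ) x, ∑ k ∈ Icc (-K) K, (c k : ℂ) * e k x =
        ((∑ k ∈ Icc (-K) K, c k * max 0 (1 - |N * g x - k|) : ℝ) : ℂ) := by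
      intro c x
      rw [Complex.ofReal_sum]
      exact sum_congr rfl fun k _ => by rw [he, Complex.ofReal_mul]
    have hsum1 : ∀ x, ∑ k ∈ Icc (-K) K, max 0 (1 - |N * g x - k|) = 1 := by
      intro x
      have := sum_hat_mul (hgK x) fun _ => 1
      simpa using this
    have h1 : (1 : BoundedContinuousFunction X ℂ) = ∑ k ∈ Icc (-K) K, e k := by
      ext x
      have := hcast (fun _ => 1) x
      simp only [one_mul, hsum1, Complex.ofReal_one] at this
      rw [BoundedContinuousFunction.finsetSum_apply, this]
      rfl
    have hN : (N : ℂ) • f = ∑ k ∈ Icc (-K) K, (k : ℂ) • e k := by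
      ext x
      have := hcast (fun k => k) x
      rw [sum_hat_mul (hgK x)] at this
      rw [BoundedContinuousFunction.finsetSum_apply]
      simp only [BoundedContinuousFunction.coe_smul, smul_eq_mul, hfg]
      refine Eq.trans ?_ this.symm
      rw [← Complex.ofReal_natCast, ← Complex.ofReal_mul]
      congr 1
      push_cast
      have : Int.fract (N * g x) = N * g x - ⌊N * g x⌋ := rfl
      rw [this]
      ring
    have hUV : ∀ z : ℂ, ‖z‖ = 1 → ‖∑ k ∈ Icc (-K) K, z ^ k • e k‖ ≤ 1 := by
      intro z hz
      refine (BoundedContinuousFunction.norm_le zero_le_one).2 fun x => ?_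
      rw [BoundedContinuousFunction.finsetSum_apply, ← hsum1 x]
      refine (norm_sum_le _ _).trans (sum_le_sum fun k _ => ?_)
      simp only [BoundedContinuousFunction.coe_smul, smul_eq_mul, he]
      rw [norm_mul, norm_zpow, hz, one_zpow, one_mul, Complex.norm_real,
        Real.norm_of_nonneg (le_max_left _ _)]
    have hbil : ∀ c d : ℤ → ℂ, β (∑ k ∈ Icc (-K) K, c k • e k) (∑ l ∈ Icc (-K) K, d l • e l) =
        ∑ k ∈ Icc (-K) K, ∑ l ∈ Icc (-K) K, (c k * d l) • β (e k) (e l) := by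
      intro c d
      rw [map_sum β, LinearMap.sum_apply]
      refine sum_congr rfl fun k _ => ?_
      rw [map_sum]
      refine sum_congr rfl fun l _ => ?_
      rw [map_smul β, LinearMap.smul_apply, map_smul, smul_smul]
    have h1' : (1 : BoundedContinuousFunction X ℂ) = ∑ k ∈ Icc (-K) K, (1 : ℂ) • e k := by
      simpa using h1
    have hdiff : (N : ℂ) • (β f 1 - β 1 f) =
        ∑ k ∈ Icc (-K) K, ∑ l ∈ Icc (-K) K, ((k : ℂ) - l) • β (e k) (e l) := by
      have a1 : (N : ℂ) • β f 1 = β ((N : ℂ) • f) 1 := by rw [map_smul, LinearMap.smul_apply]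
      have a2 : (N : ℂ) • β 1 f = β 1 ((N : ℂ) • f) := by rw [map_smul]
      rw [smul_sub, a1, a2, hN, h1', hbil, hbil, ← sum_sub_distrib]
      refine sum_congr rfl fun k _ => ?_
      rw [← sum_sub_distrib]
      refine sum_congr rfl fun l _ => ?_
      rw [← sub_smul, mul_one, one_mul]
    have hI0 := Complex.I_ne_zero
    -- `β (e k) (e l)` vanishes unless `|k - l| ≤ 1`, and for those indices `I ^ (k - l) - I ^ (l -
    -- k) = 2 * I * (k - l)`. The weights `k - l` can thus be traded for unimodular ones, which
    -- gives a bound independent of `N`.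
    have hcomm : (2 * Complex.I) • ((N : ℂ) • (β f 1 - β 1 f)) =
        β (∑ k ∈ Icc (-K) K, Complex.I ^ k • e k) (∑ k ∈ Icc (-K) K, (-Complex.I) ^ k • e k) -
        β (∑ k ∈ Icc (-K) K, (-Complex.I) ^ k • e k) (∑ k ∈ Icc (-K) K, Complex.I ^ k • e k) := by
      rw [hdiff, hbil, hbil, ← sum_sub_distrib, smul_sum]
      refine sum_congr rfl fun k _ => ?_
      rw [← sum_sub_distrib, smul_sum]
      refine sum_congr rfl fun l _ => ?_
      rw [← sub_smul, smul_smul]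
      have hinv : -Complex.I = Complex.I⁻¹ := Complex.inv_I.symm
      have hcoef : Complex.I ^ k * (-Complex.I) ^ l - (-Complex.I) ^ k * Complex.I ^ l =
          Complex.I ^ (k - l) - Complex.I ^ (l - k) := by
        rw [hinv, inv_zpow, inv_zpow, zpow_sub₀ hI0, zpow_sub₀ hI0, div_eq_mul_inv,
          div_eq_mul_inv, mul_comm (_⁻¹) (Complex.I ^ l)]
      rw [hcoef]
      by_cases hkl : k = l + 1 ∨ k = l ∨ l = k + 1
      · congr 1
        rcases hkl with rfl | rfl | rfl
        · rw [show l + 1 - l = 1 by ring, show l - (l + 1) = -1 by ring, zpow_one, zpow_neg_one,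
            Complex.inv_I]
          push_cast
          ring
        · simp
        · rw [show k + 1 - k = 1 by ring, show k - (k + 1) = -1 by ring, zpow_one, zpow_neg_one,
            Complex.inv_I]
          push_cast
          ring
      · have : β (e k) (e l) = 0 := by
          refine hβ _ _ ?_
          ext x
          rw [BoundedContinuousFunction.mul_apply, he, he, ← Complex.ofReal_mul]
          rw [BoundedContinuousFunction.coe_zero, Pi.zero_apply, Complex.ofReal_eq_zero,
            mul_eq_zero]
          by_contra hne
          rw [not_or] at hne
          have a1 : |N * g x - k| < 1 := by
            by_contra h; exact hne.1 (max_eq_left (by linarith))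
          have a2 : |N * g x - l| < 1 := by
            by_contra h; exact hne.2 (max_eq_left (by linarith))
          rw [abs_lt] at a1 a2
          have b1 : (k : ℝ) < l + 2 := by linarith
          have b2 : (l : ℝ) < k + 2 := by linarith
          have b1' : k < l + 2 := by exact_mod_cast b1
          have b2' : l < k + 2 := by exact_mod_cast b2
          omega
        rw [this, smul_zero, smul_zero]
    have hb : ∀ a b, ‖a‖ ≤ 1 → ‖b‖ ≤ 1 → ‖β a b‖ ≤ |C| := by
      intro a b ha hb
      refine (hC a b).trans ?_
      have : ‖a‖ * ‖b‖ ≤ 1 := mul_le_one₀ ha (norm_nonneg _) hb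
      calc C * ‖a‖ * ‖b‖ = C * (‖a‖ * ‖b‖) := mul_assoc _ _ _
        _ ≤ |C| * (‖a‖ * ‖b‖) := mul_le_mul_of_nonneg_right (le_abs_self C) (by positivity)
        _ ≤ |C| := mul_le_of_le_one_right hC0 this
    have hI1 := hUV Complex.I Complex.norm_I
    have hI2 := hUV (-Complex.I) (by rw [norm_neg, Complex.norm_I])
    have := congrArg norm hcomm
    rw [norm_smul, norm_smul, norm_mul, Complex.norm_I, Complex.norm_natCast] at this
    have h2 := (norm_sub_le _ _).trans (add_le_add (hb _ _ hI1 hI2) (hb _ _ hI2 hI1))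
    rw [← this] at h2
    norm_num at h2
    linarith
  by_contra hne
  have hpos : 0 < ‖β f 1 - β 1 f‖ := norm_pos_iff.2 (sub_ne_zero.2 hne)
  obtain ⟨N, hN⟩ := exists_nat_gt (|C| / ‖β f 1 - β 1 f‖)
  rw [div_lt_iff₀ hpos] at hN
  exact absurd (key N) (not_le.2 hN)

theorem zero_product_balanced {X F : Type*} [TopologicalSpace X] [NormedAddCommGroup F]
    [NormedSpace ℂ F]
    (β : BoundedContinuousFunction X ℂ →ₗ[ℂ] BoundedContinuousFunction X ℂ →ₗ[ℂ] F)
    {C : ℝ} (hC : ∀ a b, ‖β a b‖ ≤ C * ‖a‖ * ‖b‖) (hβ : ∀ a b, a * b = 0 → β a b = 0)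
    (f : BoundedContinuousFunction X ℂ) : β f 1 = β 1 f := by
  have key : ∀ φ : ℂ → ℝ, Continuous φ → (∀ z, |φ z| ≤ ‖z‖) →
      ∃ g : BoundedContinuousFunction X ℂ, (∀ x, g x = φ (f x)) ∧ β g 1 = β 1 g := by
    intro φ hφ hb
    have hf := f.continuous
    refine ⟨BoundedContinuousFunction.ofNormedAddCommGroup (fun x => (φ (f x) : ℂ))
      (by fun_prop) ‖f‖ fun x => ?_, fun x => rfl, ?_⟩
    · rw [Complex.norm_real]
      exact (hb _).trans (f.norm_coe_le_norm x)
    · exact zero_product_balanced_real β hC hβ _ (fun x => φ (f x)) (by fun_prop) fun x => rfl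
  obtain ⟨g, hg, hg'⟩ := key Complex.re (by fun_prop) Complex.abs_re_le_norm
  obtain ⟨h, hh, hh'⟩ := key Complex.im (by fun_prop) Complex.abs_im_le_norm
  have : f = g + Complex.I • h := by
    ext x
    simp only [BoundedContinuousFunction.coe_add, BoundedContinuousFunction.coe_smul,
      Pi.add_apply, hg, hh, smul_eq_mul]
    rw [mul_comm, Complex.re_add_im]
  rw [this, map_add, map_add, map_smul, map_smul, LinearMap.add_apply, LinearMap.smul_apply,
    hg', hh']

-- Local linearization of the polynomial

open Finset in
/-- An orthosymmetric bounded multilinear map on `C₀(X, ℂ)` only depends on the product of its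
multipliers. -/
theorem map_bsmul_eq {X ι F : Type*} [TopologicalSpace X] [Fintype ι]
    [DecidableEq ι] [NormedAddCommGroup F] [NormedSpace ℂ F]
    (L : ContinuousMultilinearMap ℂ (fun _ : ι => C₀(X, ℂ)) F)
    (hL : ∀ (v : ι → C₀(X, ℂ)) (i j : ι), i ≠ j → v i * v j = 0 → L v = 0)
    (v : ι → C₀(X, ℂ)) {i j : ι} (hij : i ≠ j) (f : BoundedContinuousFunction X ℂ) :
    L (Function.update v i (bsmul f (v i))) = L (Function.update v j (bsmul f (v j))) := by
  -- All slots but `i` and `j` are frozen; orthosymmetry makes the resulting bilinear map vanish on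
  -- zero products.
  let β : BoundedContinuousFunction X ℂ →ₗ[ℂ] BoundedContinuousFunction X ℂ →ₗ[ℂ] F :=
    LinearMap.mk₂ ℂ
      (fun a b => L (Function.update (Function.update v i (bsmul a (v i))) j (bsmul b (v j))))
      (fun a a' b => by
        simp only [Function.update_comm hij, map_add, LinearMap.add_apply, L.map_update_add])
      (fun c a b => by
        simp only [Function.update_comm hij, map_smul, LinearMap.smul_apply, L.map_update_smul])
      (fun a b b' => by simp only [map_add, LinearMap.add_apply, L.map_update_add])
      (fun c a b => by simp only [map_smul, LinearMap.smul_apply, L.map_update_smul])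
  have hβ : ∀ a b, β a b =
    L (Function.update (Function.update v i (bsmul a (v i))) j (bsmul b (v j))) := fun _ _ => rfl
  have h1 : ∀ u : C₀(X, ℂ), bsmul 1 u = u := fun u => by ext x; simp
  have h := zero_product_balanced β (C := ‖L‖ * ∏ k, ‖v k‖) (fun a b => ?_) (fun a b hab => ?_) f
  · rw [hβ, hβ, h1, h1, Function.update_eq_self, Function.update_comm hij,
      Function.update_eq_self] at h
    exact h
  · rw [hβ]
    refine (L.le_opNorm _).trans ?_
    rw [mul_assoc, mul_assoc]
    refine mul_le_mul_of_nonneg_left ?_ (norm_nonneg _)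
    rw [← mul_prod_erase univ _ (mem_univ j),
      ← mul_prod_erase (univ.erase j) _ (mem_erase.2 ⟨hij, mem_univ i⟩),
      ← mul_prod_erase univ (fun k => ‖v k‖) (mem_univ j),
      ← mul_prod_erase (univ.erase j) (fun k => ‖v k‖) (mem_erase.2 ⟨hij, mem_univ i⟩)]
    rw [Function.update_self, Function.update_of_ne hij, Function.update_self]
    have : ∏ k ∈ (univ.erase j).erase i,
        ‖Function.update (Function.update v i (bsmul a (v i))) j (bsmul b (v j)) k‖ =
        ∏ k ∈ (univ.erase j).erase i, ‖v k‖ := by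
      refine prod_congr rfl fun k hk => ?_
      rw [mem_erase, mem_erase] at hk
      rw [Function.update_of_ne hk.2.1, Function.update_of_ne hk.1]
    rw [this]
    set Q := ∏ k ∈ (univ.erase j).erase i, ‖v k‖
    have hQ : 0 ≤ Q := prod_nonneg fun _ _ => norm_nonneg _
    calc ‖bsmul b (v j)‖ * (‖bsmul a (v i)‖ * Q)
        ≤ (‖b‖ * ‖v j‖) * ((‖a‖ * ‖v i‖) * Q) := by
          gcongr <;> exact norm_bsmul_le _ _
      _ = ‖v j‖ * (‖v i‖ * Q) * (‖a‖ * ‖b‖) := by ring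
  · rw [hβ]
    refine hL _ i j hij ?_
    rw [Function.update_of_ne hij, Function.update_self, Function.update_self]
    ext x
    have := DFunLike.congr_fun hab x
    rw [BoundedContinuousFunction.mul_apply] at this
    rw [ZeroAtInftyContinuousMap.mul_apply, bsmul_apply, bsmul_apply, mul_mul_mul_comm, this]
    exact zero_mul _

open Finset in
theorem map_bsmul_eq_update_prod {X ι F : Type*} [TopologicalSpace X] [Fintype ι]
    [DecidableEq ι] [NormedAddCommGroup F] [NormedSpace ℂ F]
    (L : ContinuousMultilinearMap ℂ (fun _ : ι => C₀(X, ℂ)) F)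
    (hL : ∀ (v : ι → C₀(X, ℂ)) (i j : ι), i ≠ j → v i * v j = 0 → L v = 0)
    (f : BoundedContinuousFunction X ℂ) (i₀ : ι) (s : Finset ι) (v : ι → C₀(X, ℂ)) :
    L (fun i => if i ∈ s then bsmul f (v i) else v i) =
      L (Function.update v i₀ (bsmul (f ^ #s) (v i₀))) := by
  induction s using Finset.induction_on generalizing v with
  | empty =>
    have : bsmul (f ^ #(∅ : Finset ι)) (v i₀) = v i₀ := by ext x; simp
    rw [this, Function.update_eq_self]
    simp
  | insert a s ha ih =>
    set w := Function.update v a (bsmul f (v a)) with hw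
    have e1 : (fun i => if i ∈ insert a s then bsmul f (v i) else v i) =
        fun i => if i ∈ s then bsmul f (w i) else w i := by
      funext i
      by_cases hi : i = a
      · subst hi
        simp [ha, hw]
      · simp [hi, hw]
    rw [e1, ih w, card_insert_of_notMem ha]
    have hpow : ∀ u : C₀(X, ℂ), bsmul (f ^ #s) (bsmul f u) = bsmul (f ^ (#s + 1)) u := by
      intro u; ext x; simp [pow_succ, mul_assoc]
    rcases eq_or_ne a i₀ with rfl | hne
    · rw [hw, Function.update_self, Function.update_idem, hpow]
    · set z := Function.update v i₀ (bsmul (f ^ #s) (v i₀)) with hz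
      have e2 : Function.update w i₀ (bsmul (f ^ #s) (w i₀)) =
          Function.update z a (bsmul f (z a)) := by
        rw [hw, hz, Function.update_of_ne hne.symm, Function.update_of_ne hne,
          Function.update_comm hne]
      rw [e2, map_bsmul_eq L hL z hne, hz, Function.update_self, Function.update_idem]
      congr 2
      ext x
      simp [pow_succ]
      ring

/-- Here `T e u = L(u, e, ..., e)`: writing each argument `f` as `f * e`, all `n` factors `f` are
moved into one slot. -/
theorem exists_local_linearization {X F : Type*} [TopologicalSpace X] [NormedAddCommGroup F]
    [NormedSpace ℂ F] {n : ℕ} (hn : 1 ≤ n) (P : C₀(X, ℂ) → F)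
    (hP : IsHomogeneousPolynomial n P)
    (hadd : ∀ f g : C₀(X, ℂ), f * g = 0 → P (f + g) = P f + P g)
    (hpos : ∀ f : C₀(X, ℂ), IsPositiveFunction f → ‖P f‖ ≤ ‖f‖ ^ n) :
    Continuous P ∧ ∃ T : C₀(X, ℂ) → C₀(X, ℂ) →ₗ[ℂ] F,
      ∀ f e : C₀(X, ℂ), f * e = f → P f = T e (bsmul (f.toBCF ^ n) e) := by
  obtain ⟨L, hsymm, hPL⟩ := hP
  obtain ⟨C, hC⟩ := exists_bound_of_bound_on_positive L hsymm fun f hf => by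
    rw [← hPL, Fintype.card_fin]; exact hpos f hf
  have h0 := map_eq_zero_of_orthogonal_compl L hsymm fun f g hfg => by
    rw [← hPL, ← hPL, ← hPL]; exact hadd f g hfg
  set M := L.mkContinuous C hC
  have hPM : ∀ f, P f = M fun _ => f := hPL
  have h1 : ∀ (v : Fin n → C₀(X, ℂ)) (i j : Fin n), i ≠ j → v i * v j = 0 → M v = 0 := by
    intro v i j hij hv
    refine map_eq_zero_of_orthogonal M (fun v A a b ha hb h => h0 v A ha hb h) v {i} {j}
      (by simpa using hij) (Finset.mem_singleton_self i) (Finset.mem_singleton_self j) ?_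
    intro i' hi j' hj
    rw [Finset.mem_singleton.1 hi, Finset.mem_singleton.1 hj, hv]
  have i₀ : Fin n := ⟨0, hn⟩
  refine ⟨?_, fun e => L.toLinearMap (fun _ => e) i₀, fun f e hfe => ?_⟩
  · rw [funext hPM]
    exact M.cont.comp (continuous_pi fun _ => continuous_id)
  · have := map_bsmul_eq_update_prod M h1 f.toBCF i₀ Finset.univ fun _ => e
    have hf : bsmul f.toBCF e = f := hfe
    simp only [Finset.mem_univ, if_true, hf, Finset.card_univ, Fintype.card_fin] at this
    rw [hPM, this]
    rfl

-- Positive functions with local units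

theorem mul_eq_self_iff {X : Type*} [TopologicalSpace X] {w e : C₀(X, ℂ)} :
    w * e = w ↔ ∀ x, w x = 0 ∨ e x = 1 := by
  rw [DFunLike.ext_iff]
  refine forall_congr' fun x => ?_
  rw [ZeroAtInftyContinuousMap.mul_apply, mul_right_eq_self₀, or_comm]

theorem IsPositiveFunction.apply_eq_norm {X : Type*} [TopologicalSpace X] {f : C₀(X, ℂ)}
    (hf : IsPositiveFunction f) (x : X) : f x = (‖f x‖ : ℂ) := by
  have h : f x = ((f x).re : ℂ) := Complex.ext rfl (hf x).2
  rw [h, Complex.norm_real, Real.norm_of_nonneg (hf x).1]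

theorem IsPositiveFunction.exists_root {X : Type*} [TopologicalSpace X] {n : ℕ} (hn : 1 ≤ n)
    {w : C₀(X, ℂ)} (hw : IsPositiveFunction w) (e : C₀(X, ℂ)) (he : w * e = w) :
    ∃ r : C₀(X, ℂ), IsPositiveFunction r ∧ (∀ x, r x ^ n = w x) ∧ ‖r‖ ^ n = ‖w‖ := by
  have hn0 : n ≠ 0 := by omega
  have hinv : (0 : ℝ) < (n : ℝ)⁻¹ := by positivity
  have hcw := map_continuous w
  set ρ : X → ℝ := fun x => ‖w x‖ ^ (n : ℝ)⁻¹
  have hρ0 : ∀ x, 0 ≤ ρ x := fun x => Real.rpow_nonneg (norm_nonneg _) _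
  have hρ : Continuous ρ := hcw.norm.rpow_const fun x => Or.inr hinv.le
  have hρn : ∀ x, ρ x ^ n = ‖w x‖ := fun x => Real.rpow_inv_natCast_pow (norm_nonneg _) hn0
  have hle : ∀ x, ρ x ≤ ‖w‖ ^ (n : ℝ)⁻¹ := fun x =>
    Real.rpow_le_rpow (norm_nonneg _) (w.norm_apply_le x) hinv.le
  have hnorm : ∀ x, ‖((ρ x : ℝ) : ℂ)‖ = ρ x := fun x => by
    rw [Complex.norm_real, Real.norm_of_nonneg (hρ0 x)]
  obtain ⟨r, hr⟩ : ∃ r : C₀(X, ℂ), ∀ x, r x = ((ρ x : ℝ) : ℂ) := by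
    -- The root vanishes wherever `e ≠ 1`, so a multiple of `e` dominates it.
    refine ⟨ofDominated e (‖w‖ ^ (n : ℝ)⁻¹) (fun x => (ρ x : ℂ)) (by fun_prop) fun x => ?_,
      fun x => rfl⟩
    rw [hnorm]
    rcases mul_eq_self_iff.1 he x with hx | hx
    · have : ρ x = 0 := by simp only [ρ, hx, norm_zero, Real.zero_rpow hinv.ne']
      rw [this]
      positivity
    · rw [hx, norm_one, mul_one]
      exact hle x
  refine ⟨r, fun x => ?_, fun x => ?_, le_antisymm ?_ ?_⟩
  · rw [hr, Complex.ofReal_re, Complex.ofReal_im]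
    exact ⟨hρ0 x, rfl⟩
  · rw [hr, ← Complex.ofReal_pow, hρn, ← hw.apply_eq_norm]
  · refine (pow_le_pow_left₀ (norm_nonneg _) ?_ n).trans_eq
      (Real.rpow_inv_natCast_pow (norm_nonneg w) hn0)
    rw [ZeroAtInftyContinuousMap.norm_le_iff (by positivity)]
    intro x
    rw [hr, hnorm]
    exact hle x
  · rw [ZeroAtInftyContinuousMap.norm_le_iff (by positivity)]
    intro x
    rw [← hρn, ← hnorm, ← hr]
    exact pow_le_pow_left₀ (norm_nonneg _) (r.norm_apply_le x) n

/-- Local linearizations agree on positive functions, and are isometric on them. -/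
theorem linearization_positive {X F : Type*} [TopologicalSpace X] [NormedAddCommGroup F]
    [NormedSpace ℂ F] {n : ℕ} (hn : 1 ≤ n) (P : C₀(X, ℂ) → F)
    (hiso : ∀ f : C₀(X, ℂ), IsPositiveFunction f → ‖P f‖ = ‖f‖ ^ n)
    (T : C₀(X, ℂ) → C₀(X, ℂ) →ₗ[ℂ] F)
    (hT : ∀ f e : C₀(X, ℂ), f * e = f → P f = T e (bsmul (f.toBCF ^ n) e))
    {w : C₀(X, ℂ)} (hw : IsPositiveFunction w) {e : C₀(X, ℂ)} (he : w * e = w) :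
    ‖T e w‖ = ‖w‖ ∧ ∀ e' : C₀(X, ℂ), w * e' = w → T e w = T e' w := by
  obtain ⟨r, hr, hrn, hrw⟩ := hw.exists_root hn e he
  -- The root `r` has the zeros of `w`, hence the same local units; `P r` does not involve the
  -- choice among them.
  have h1 : ∀ e' : C₀(X, ℂ), w * e' = w → P r = T e' w := by
    intro e' he'
    have hre : r * e' = r := mul_eq_self_iff.2 fun x =>
      (mul_eq_self_iff.1 he' x).imp_left fun hx => by
        rw [← hrn] at hx
        exact (pow_eq_zero_iff (by omega)).1 hx
    rw [hT r e' hre]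
    congr 1
    ext x
    have := DFunLike.congr_fun he' x
    rw [ZeroAtInftyContinuousMap.mul_apply, ← hrn] at this
    rw [bsmul_apply, ← hrn]
    exact this
  refine ⟨by rw [← h1 e he, hiso r hr, hrw], fun e' he' => by rw [← h1 e he, h1 e' he']⟩

open Finset in
/-- If the sum of complex numbers of modulus at most one has maximal modulus, then they coincide
and have modulus one. -/
theorem eq_of_norm_sum_eq_card {ι : Type*} (s : Finset ι) (z : ι → ℂ) (hz : ∀ i ∈ s, ‖z i‖ ≤ 1)
    (h : ‖∑ i ∈ s, z i‖ = #s) {i : ι} (hi : i ∈ s) :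
    ‖z i‖ = 1 ∧ ∀ j ∈ s, z j = z i := by
  have hs : (0 : ℝ) < #s := by exact_mod_cast card_pos.2 ⟨i, hi⟩
  set σ := ∑ i ∈ s, z i
  have hσ : σ ≠ 0 := norm_pos_iff.1 (h ▸ hs)
  set c : ℂ := σ / #s
  have hc : ‖c‖ = 1 := by
    rw [norm_div, h, Complex.norm_natCast, div_self hs.ne']
  have hconj : (starRingEnd ℂ) c * c = 1 := by
    rw [mul_comm, Complex.mul_conj, Complex.normSq_eq_norm_sq, hc]; simp
  have hnorm : ∀ j ∈ s, ‖(starRingEnd ℂ) c * z j‖ ≤ 1 := fun j hj => by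
    rw [norm_mul, RCLike.norm_conj, hc, one_mul]; exact hz j hj
  have hre : ∀ j ∈ s, ((starRingEnd ℂ) c * z j).re ≤ 1 := fun j hj =>
    (Complex.re_le_norm _).trans (hnorm j hj)
  have hsum : ∑ j ∈ s, ((starRingEnd ℂ) c * z j).re = ∑ _j ∈ s, (1 : ℝ) := by
    rw [← Complex.re_sum, ← mul_sum]
    have : σ = c * #s := by
      rw [div_mul_cancel₀]; exact_mod_cast hs.ne'
    change ((starRingEnd ℂ) c * σ).re = _
    rw [this, ← mul_assoc, hconj, one_mul, sum_const, nsmul_eq_mul, mul_one, Complex.natCast_re]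
  have hall := (sum_eq_sum_iff_of_le hre).1 hsum
  have hzc : ∀ j ∈ s, z j = c := by
    intro j hj
    have h1 := hall j hj
    have h2 : (starRingEnd ℂ) c * z j = 1 := by
      set u := (starRingEnd ℂ) c * z j
      have h3 := Complex.sq_norm_sub_sq_re u
      have h4 := hnorm j hj
      rw [h1] at h3
      have h5 : u.im = 0 := by
        have h6 : ‖u‖ ^ 2 ≤ 1 := pow_le_one₀ (norm_nonneg _) h4
        exact pow_eq_zero_iff two_ne_zero |>.1 (le_antisymm (by linarith) (sq_nonneg _))
      exact Complex.ext h1 h5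
    calc z j = ((starRingEnd ℂ) c * c) * z j := by rw [hconj, one_mul]
      _ = c * ((starRingEnd ℂ) c * z j) := by ring
      _ = c := by rw [h2, mul_one]
  refine ⟨by rw [hzc i hi, hc], fun j hj => by rw [hzc j hj, hzc i hi]⟩

/-- A bump function equal to one on a compact set, together with a local unit for it. -/
theorem exists_bump {X : Type*} [TopologicalSpace X] [LocallyCompactSpace X] [T2Space X]
    {K : Set X} (hK : IsCompact K) :
    ∃ b E : C₀(X, ℂ), IsPositiveFunction b ∧ ‖b‖ ≤ 1 ∧ (∀ x ∈ K, b x = 1) ∧ b * E = b := by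
  obtain ⟨g, hg1, -, hgc, hg01⟩ := exists_continuous_one_zero_of_isCompact hK isClosed_empty
    (Set.disjoint_empty K)
  obtain ⟨k, hk1, -, hkc, -⟩ := exists_continuous_one_zero_of_isCompact hgc isClosed_empty
    (Set.disjoint_empty _)
  have key : ∀ g : C(X, ℝ), HasCompactSupport g → ∃ b : C₀(X, ℂ), ∀ x, b x = (g x : ℂ) :=
    fun g hg => ⟨⟨⟨fun x => (g x : ℂ), by fun_prop⟩,
      (hg.comp_left Complex.ofReal_zero).is_zero_at_infty⟩, fun x => rfl⟩
  obtain ⟨b, hb⟩ := key g hgc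
  obtain ⟨E, hE⟩ := key k hkc
  refine ⟨b, E, fun x => ?_, ?_, fun x hx => ?_, ?_⟩
  · rw [hb, Complex.ofReal_re, Complex.ofReal_im]
    exact ⟨(hg01 x).1, rfl⟩
  · rw [ZeroAtInftyContinuousMap.norm_le_iff zero_le_one]
    intro x
    rw [hb, Complex.norm_real, Real.norm_of_nonneg (hg01 x).1]
    exact (hg01 x).2
  · rw [hb, hg1 hx]; simp
  · ext x
    rw [ZeroAtInftyContinuousMap.mul_apply, hb, hE]
    by_cases hx : g x = 0
    · rw [hx]; simp
    · rw [hk1 (subset_tsupport _ hx)]; simp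

theorem ZeroAtInftyContinuousMap.continuous_apply {X : Type*} [TopologicalSpace X] (x : X) :
    Continuous fun f : C₀(X, ℂ) => f x := by
  refine (LipschitzWith.of_dist_le_mul (K := 1) fun f g => ?_).continuous
  rw [dist_eq_norm, dist_eq_norm, NNReal.coe_one, one_mul,
    ← ZeroAtInftyContinuousMap.sub_apply]
  exact ZeroAtInftyContinuousMap.norm_apply_le _ x

theorem ZeroAtInftyContinuousMap.isCompact_setOf_le_norm {X : Type*} [TopologicalSpace X]
    (f : C₀(X, ℂ)) {δ : ℝ} (hδ : 0 < δ) : IsCompact {x | δ ≤ ‖f x‖} := by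
  have h : ∀ᶠ x in Filter.cocompact X, ‖f x‖ < δ := by
    have := (zero_at_infty f).norm
    rw [norm_zero] at this
    exact this.eventually (gt_mem_nhds hδ)
  obtain ⟨K, hK, hKs⟩ := Filter.mem_cocompact.1 h
  refine hK.of_isClosed_subset (isClosed_le continuous_const (map_continuous f).norm) ?_
  intro x hx
  by_contra hxK
  exact (not_lt.2 (show δ ≤ ‖f x‖ from hx)) (show ‖f x‖ < δ from hKs hxK)

theorem ZeroAtInftyContinuousMap.exists_norm_apply_eq {X : Type*} [TopologicalSpace X]
    (f : C₀(X, ℂ)) (hf : 0 < ‖f‖) : ∃ x, ‖f x‖ = ‖f‖ := by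
  have hne : ∃ x, ‖f‖ / 2 ≤ ‖f x‖ := by
    by_contra! h
    have := (ZeroAtInftyContinuousMap.norm_le_iff (by positivity)).2 fun x => (h x).le
    linarith
  obtain ⟨x, hx, hmax⟩ := (f.isCompact_setOf_le_norm (half_pos hf)).exists_isMaxOn hne
    (map_continuous f).norm.continuousOn
  refine ⟨x, le_antisymm (f.norm_apply_le x) ?_⟩
  rw [ZeroAtInftyContinuousMap.norm_le_iff (norm_nonneg _)]
  intro z
  by_cases hz : ‖f‖ / 2 ≤ ‖f z‖
  · exact hmax hz
  · exact (not_le.1 hz).le.trans hx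

theorem exists_common_local_unit {X ι : Type*} [TopologicalSpace X] (s : Finset ι)
    (w : ι → C₀(X, ℂ)) (h : ∀ i ∈ s, ∃ e, w i * e = w i) : ∃ e, ∀ i ∈ s, w i * e = w i := by
  classical
  induction s using Finset.induction_on with
  | empty => exact ⟨0, by simp⟩
  | insert a s _ ih =>
    obtain ⟨e, he⟩ := ih fun i hi => h i (Finset.mem_insert_of_mem hi)
    obtain ⟨e', he'⟩ := h a (Finset.mem_insert_self a s)
    -- This is `1 - (1 - e) * (1 - e')`, equal to 1 wherever `e` or `e'` is.
    refine ⟨e + e' - e * e', fun i hi => ?_⟩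
    rw [mul_sub, mul_add, ← mul_assoc]
    rcases Finset.mem_insert.1 hi with rfl | hi
    · rw [mul_assoc, mul_comm e e', ← mul_assoc, he']
      abel
    · rw [he i hi]
      abel

/-- Positive norm-one functions with a local unit which attain their norm at `x`. -/
def IsPeakAt {X : Type*} [TopologicalSpace X] (x : X) (w : C₀(X, ℂ)) : Prop :=
  IsPositiveFunction w ∧ ‖w‖ ≤ 1 ∧ w x = 1 ∧ ∃ e, w * e = w

-- Peak functions and evaluation points

-- A sum of `k` peak functions at `x` has norm `k`, and so has its image. Where the image attains
-- this norm, its `k` summands, each of modulus at most 1, must coincide and be unimodular.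
-- Compactness passes from finite families to all peak functions.
open Finset in
theorem exists_common_value {X Y : Type*} [TopologicalSpace X] [LocallyCompactSpace X] [T2Space X]
    [TopologicalSpace Y] (T : C₀(X, ℂ) → C₀(X, ℂ) →ₗ[ℂ] C₀(Y, ℂ))
    (hT : ∀ w e : C₀(X, ℂ), IsPositiveFunction w → w * e = w →
      ‖T e w‖ = ‖w‖ ∧ ∀ e' : C₀(X, ℂ), w * e' = w → T e w = T e' w) (x : X) :
    ∃ (y : Y) (h : ℂ), ‖h‖ = 1 ∧ ∀ w e, IsPeakAt x w → w * e = w → T e w y = h := by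
  classical
  obtain ⟨w₀, e₀, hw₀, hw₀1, hw₀x, hwe₀⟩ := exists_bump (isCompact_singleton (x := x))
  have hp₀ : IsPeakAt x w₀ := ⟨hw₀, hw₀1, hw₀x x rfl, e₀, hwe₀⟩
  choose e he using fun w : {w // IsPeakAt x w} => w.2.2.2.2
  let τ : {w // IsPeakAt x w} → C₀(Y, ℂ) := fun w => T (e w) w
  set p₀ : {w // IsPeakAt x w} := ⟨w₀, hp₀⟩
  have hcompact : IsCompact {y | 1 ≤ ‖τ p₀ y‖} := (τ p₀).isCompact_setOf_le_norm one_pos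
  have hfin : ∀ u : Finset {w // IsPeakAt x w},
      ({y | 1 ≤ ‖τ p₀ y‖} ∩ ⋂ w ∈ u, {y | τ w y = τ p₀ y}).Nonempty := by
    intro u
    set s := insert p₀ u
    obtain ⟨E, hE⟩ := exists_common_local_unit s (fun w => (w : C₀(X, ℂ))) fun w _ => ⟨e w, he w⟩
    have hτ : ∀ w ∈ s, τ w = T E w := fun w hw => (hT w _ w.2.1 (he w)).2 E (hE w hw)
    set σ : C₀(X, ℂ) := ∑ w ∈ s, (w : C₀(X, ℂ))
    have hs : (0 : ℝ) < #s := by exact_mod_cast card_pos.2 ⟨p₀, mem_insert_self _ _⟩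
    have hσpos : IsPositiveFunction σ := fun z => by
      rw [ZeroAtInftyContinuousMap.sum_apply, Complex.re_sum, Complex.im_sum]
      exact ⟨sum_nonneg fun w _ => (w.2.1 z).1, sum_eq_zero fun w _ => (w.2.1 z).2⟩
    have hσE : σ * E = σ := by
      rw [sum_mul]; exact sum_congr rfl hE
    have hσn : ‖σ‖ = #s := by
      refine le_antisymm ?_ ?_
      · refine (norm_sum_le _ _).trans ((sum_le_sum fun w _ => w.2.2.1).trans ?_)
        simp
      · have : ‖σ x‖ = #s := by
          rw [ZeroAtInftyContinuousMap.sum_apply, sum_congr rfl fun w _ => w.2.2.2.1]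
          simp
        rw [← this]
        exact σ.norm_apply_le x
    have hTσ : ‖T E σ‖ = #s := by rw [(hT σ E hσpos hσE).1, hσn]
    obtain ⟨y, hy⟩ := (T E σ).exists_norm_apply_eq (by rw [hTσ]; exact hs)
    have hsum : T E σ y = ∑ w ∈ s, τ w y := by
      rw [map_sum, ZeroAtInftyContinuousMap.sum_apply]
      exact sum_congr rfl fun w hw => by rw [hτ w hw]
    rw [hsum, hTσ] at hy
    have hall := eq_of_norm_sum_eq_card s (fun w => τ w y) (fun w _ =>
      ((τ w).norm_apply_le y).trans ((hT w _ w.2.1 (he w)).1.trans_le w.2.2.1)) hy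
      (mem_insert_self p₀ u)
    refine ⟨y, hall.1.ge, ?_⟩
    rw [Set.mem_iInter₂]
    exact fun w hw => hall.2 w (mem_insert_of_mem hw)
  obtain ⟨y, hy0, hy⟩ := hcompact.inter_iInter_nonempty
    (fun w => {y | τ w y = τ p₀ y})
    (fun w => isClosed_eq (map_continuous _) (map_continuous _)) hfin
  rw [Set.mem_iInter] at hy
  have hle : ‖τ p₀ y‖ ≤ 1 :=
    ((τ p₀).norm_apply_le y).trans ((hT _ _ hw₀ (he p₀)).1.trans_le hw₀1)
  refine ⟨y, τ p₀ y, le_antisymm hle hy0, fun w e' hw hwe => ?_⟩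
  rw [(hT w e' hw.1 hwe).2 _ (he ⟨w, hw⟩)]
  exact hy ⟨w, hw⟩

theorem exists_evaluation_point {X Y : Type*} [TopologicalSpace X] [LocallyCompactSpace X]
    [T2Space X] [TopologicalSpace Y] {n : ℕ} (hn : 1 ≤ n) (P : C₀(X, ℂ) → C₀(Y, ℂ))
    (hP : IsHomogeneousPolynomial n P)
    (hadd : ∀ f g : C₀(X, ℂ), f * g = 0 → P (f + g) = P f + P g)
    (hiso : IsNIsometryOnPositive n P) (x : X) :
    ∃ (y : Y) (h : ℂ), ‖h‖ = 1 ∧ ∀ f, P f y = h * f x ^ n := by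
  obtain ⟨hcont, T, hT⟩ := exists_local_linearization hn P hP hadd fun f hf => (hiso f hf).le
  obtain ⟨y, h, hh, hy⟩ := exists_common_value T
    (fun w e hw he => linearization_positive hn P hiso T hT hw he) x
  refine ⟨y, h, hh, fun f => ?_⟩
  have hzero : ∀ p b E : C₀(X, ℂ), IsPositiveFunction p → p x = 0 → IsPeakAt x b → p * b = p →
      b * E = b → T E p y = 0 := by
    intro p b E hp hpx hb hpb hbE
    -- The scaling gives `q ≤ 1` even when `p = 0`. As `b = 1` wherever `q ≠ 0`, `b - q` is again a
    -- peak function, with the same value `h` at `y`.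
    set q : C₀(X, ℂ) := (((‖p‖ + 1)⁻¹ : ℝ) : ℂ) • p with hq
    have hc0 : (0 : ℝ) < (‖p‖ + 1)⁻¹ := by positivity
    have hqv : ∀ z, q z = (((‖p‖ + 1)⁻¹ * ‖p z‖ : ℝ) : ℂ) := fun z => by
      rw [hq, ZeroAtInftyContinuousMap.smul_apply, smul_eq_mul, hp.apply_eq_norm z,
        Complex.norm_real, norm_norm, Complex.ofReal_mul]
    have hq1 : ∀ z, (‖p‖ + 1)⁻¹ * ‖p z‖ ≤ 1 := fun z => by
      rw [inv_mul_le_one₀ (by positivity)]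
      linarith [p.norm_apply_le z]
    have hqb : ∀ z, q z = 0 ∨ b z = 1 := fun z =>
      (mul_eq_self_iff.1 hpb z).imp_left fun hz => by rw [hqv, hz]; simp
    have hqE : q * E = q := by
      have : p * E = p := by
        conv_lhs => rw [← hpb]
        rw [mul_assoc, hbE, hpb]
      rw [hq, smul_mul_assoc, this]
    have hbq : IsPeakAt x (b - q) := by
      refine ⟨fun z => ?_, ?_, ?_, E, by rw [sub_mul, hbE, hqE]⟩
      · rw [ZeroAtInftyContinuousMap.sub_apply]
        rcases hqb z with hz | hz
        · rw [hz, sub_zero]; exact hb.1 z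
        · rw [hz, hqv, ← Complex.ofReal_one, ← Complex.ofReal_sub, Complex.ofReal_re,
            Complex.ofReal_im]
          exact ⟨sub_nonneg.2 (hq1 z), rfl⟩
      · rw [ZeroAtInftyContinuousMap.norm_le_iff zero_le_one]
        intro z
        rw [ZeroAtInftyContinuousMap.sub_apply]
        rcases hqb z with hz | hz
        · rw [hz, sub_zero]; exact (b.norm_apply_le z).trans hb.2.1
        · have : 0 ≤ (‖p‖ + 1)⁻¹ * ‖p z‖ := by positivity
          rw [hz, hqv, ← Complex.ofReal_one, ← Complex.ofReal_sub, Complex.norm_real,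
            Real.norm_of_nonneg (sub_nonneg.2 (hq1 z))]
          linarith
      · rw [ZeroAtInftyContinuousMap.sub_apply, hqv, hpx, hb.2.2.1]; simp
    have h1 := hy b E hb hbE
    have h2 := hy (b - q) E hbq (by rw [sub_mul, hbE, hqE])
    rw [map_sub, ZeroAtInftyContinuousMap.sub_apply, h1, sub_eq_self, hq, map_smul,
      ZeroAtInftyContinuousMap.smul_apply, smul_eq_mul] at h2
    exact (mul_eq_zero.1 h2).resolve_left (Complex.ofReal_ne_zero.2 hc0.ne')
  have hunit : ∀ f e : C₀(X, ℂ), f * e = f → P f y = h * f x ^ n := by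
    intro f e hfe
    have hK : ∀ e : C₀(X, ℂ), IsCompact ({x} ∪ {z | e z = 1}) := fun e =>
      isCompact_singleton.union ((e.isCompact_setOf_le_norm one_pos).of_isClosed_subset
        (isClosed_eq (map_continuous e) continuous_const) fun z hz => by
          rw [Set.mem_ofPred_eq] at hz ⊢
          rw [hz, norm_one])
    obtain ⟨b, E, hbpos, hb1, hbK, hbE⟩ := exists_bump (hK e)
    -- A second bump is needed because `v` below involves `b` itself: `B = 1` wherever `b ≠ 0`, so
    -- `hzero` applies to the positive parts of `v` with `B` in the role of the peak function.
    obtain ⟨B, E', hBpos, hB1, hBK, hBE⟩ := exists_bump (hK E)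
    have hb : IsPeakAt x b := ⟨hbpos, hb1, hbK x (.inl rfl), E, hbE⟩
    have hB : IsPeakAt x B := ⟨hBpos, hB1, hBK x (.inl rfl), E', hBE⟩
    have hbB : ∀ z, b z = 0 ∨ B z = 1 := fun z =>
      (mul_eq_self_iff.1 hbE z).imp_right fun hz => hBK z (.inr hz)
    have hbE' : ∀ z, b z = 0 ∨ E' z = 1 := fun z =>
      (hbB z).imp_right fun hz => (mul_eq_self_iff.1 hBE z).resolve_left (by rw [hz]; simp)
    have hfb : ∀ z, f z = 0 ∨ b z = 1 := fun z =>
      (mul_eq_self_iff.1 hfe z).imp_right fun hz => hbK z (.inr hz)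
    have hfE' : f * E' = f := mul_eq_self_iff.2 fun z =>
      (hfb z).imp_right fun hz => (hbE' z).resolve_left (by rw [hz]; simp)
    set w := bsmul (f.toBCF ^ n) E' with hw
    have hwz : ∀ z, w z = f z ^ n := fun z => by
      have : w z = f z ^ n * E' z := rfl
      rcases mul_eq_self_iff.1 hfE' z with hz | hz
      · rw [this, hz, zero_pow (by omega), zero_mul]
      · rw [this, hz, mul_one]
    set v := w - w x • b with hv
    have hvx : v x = 0 := by
      rw [hv, ZeroAtInftyContinuousMap.sub_apply, ZeroAtInftyContinuousMap.smul_apply,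
        hb.2.2.1, smul_eq_mul, mul_one, sub_self]
    have hvB : ∀ z, v z = 0 ∨ B z = 1 := fun z => by
      rcases hbB z with hz | hz
      · left
        have hfz : f z = 0 := (hfb z).resolve_right (by rw [hz]; simp)
        rw [hv, ZeroAtInftyContinuousMap.sub_apply, ZeroAtInftyContinuousMap.smul_apply, hz,
          smul_zero, sub_zero, hwz, hfz, zero_pow (by omega)]
      · exact Or.inr hz
    have hTv : T E' v y = 0 := by
      obtain ⟨p, hp, hpv, hsum⟩ := exists_positive_decomposition v
      have hp0 : ∀ k z, v z = 0 → p k z = 0 := fun k z hz =>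
        norm_le_zero_iff.1 ((hpv k z).trans_eq (by rw [hz, norm_zero]))
      rw [hsum, map_sum, ZeroAtInftyContinuousMap.sum_apply]
      refine Finset.sum_eq_zero fun k _ => ?_
      rw [map_smul, ZeroAtInftyContinuousMap.smul_apply,
        hzero (p k) B E' (hp k) (hp0 k x hvx) hB
          (mul_eq_self_iff.2 fun z => (hvB z).imp_left (hp0 k z)) hBE, smul_zero]
    have hTb : T E' b y = h := hy b E' hb (mul_eq_self_iff.2 hbE')
    rw [hv, map_sub, map_smul, ZeroAtInftyContinuousMap.sub_apply,
      ZeroAtInftyContinuousMap.smul_apply, hTb, sub_eq_zero] at hTv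
    rw [hT f E' hfE', ← hw, hTv, hwz, smul_eq_mul, mul_comm]
  have hclosed : IsClosed {f : C₀(X, ℂ) | P f y = h * f x ^ n} :=
    isClosed_eq ((ZeroAtInftyContinuousMap.continuous_apply y).comp hcont)
      (continuous_const.mul ((ZeroAtInftyContinuousMap.continuous_apply x).pow n))
  -- Functions with a local unit are dense: cutting `f` off where it is small provides one.
  refine hclosed.closure_subset (Metric.mem_closure_iff.2 fun δ hδ => ?_)
  obtain ⟨p, q, hp, hq, hp1, hq1, -, hpq, hps, hqs⟩ := exists_cutoff (map_continuous f).norm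
    (fun x => norm_nonneg _) (show (0 : ℝ) < δ / 4 by positivity)
  refine ⟨bsmul (unitBCF p hp hp1) f, hunit _ (ofDominated f (δ / 4)⁻¹ (fun z => (q z : ℂ))
    (by fun_prop) fun z => ?_) (mul_eq_self_iff.2 fun z => ?_), ?_⟩
  · rw [Complex.norm_real, Real.norm_of_nonneg (hq1 z).1, inv_mul_eq_div]
    exact hqs z
  · rcases hpq z with hz | hz
    · left; simp [hz]
    · right; simp [hz]
  · rw [dist_eq_norm]
    refine lt_of_le_of_lt ((ZeroAtInftyContinuousMap.norm_le_iff
      (show 0 ≤ 2 * (δ / 4) by positivity)).2 fun z => ?_) (by linarith)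
    have e : (f - bsmul (unitBCF p hp hp1) f) z = ((1 - p z : ℝ) : ℂ) * f z := by
      simp; ring
    rw [e, norm_mul, Complex.norm_real, Real.norm_of_nonneg (sub_nonneg.2 (hp1 z).2)]
    exact hps z

-- The homeomorphism

theorem exists_apply_eq_one_of_notMem_isClosed {X : Type*} [TopologicalSpace X]
    [LocallyCompactSpace X] [T2Space X] {t : Set X} (ht : IsClosed t) {x : X} (hx : x ∉ t) :
    ∃ f : C₀(X, ℂ), f x = 1 ∧ ∀ z ∈ t, f z = 0 := by
  obtain ⟨g, hg1, hg0, hgc, -⟩ := exists_continuous_one_zero_of_isCompact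
    (isCompact_singleton (x := x)) ht (Set.disjoint_singleton_left.2 hx)
  refine ⟨⟨⟨fun x => (g x : ℂ), by fun_prop⟩,
    (hgc.comp_left Complex.ofReal_zero).is_zero_at_infty⟩, ?_, fun z hz => ?_⟩
  · change ((g x : ℝ) : ℂ) = 1
    rw [hg1 rfl]; simp
  · change ((g z : ℝ) : ℂ) = 0
    rw [hg0 hz]; simp

/-- Along an ultrafilter converging to `y`, the weights stay in the unit circle, and the points of
`X` stay in a compact set where some `f₀` with `P f₀ y ≠ 0` is bounded below. Both converge, and the
formula passes to the limit. -/
theorem isClosed_setOf_weighted_evaluation {X Y : Type*} [TopologicalSpace X]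
    [TopologicalSpace Y] {n : ℕ} (hn : 1 ≤ n) (P : C₀(X, ℂ) → C₀(Y, ℂ))
    (hreg : ∀ y, ∃ f, P f y ≠ 0) :
    IsClosed {y : Y | ∃ (x : X) (h : ℂ), ‖h‖ = 1 ∧ ∀ f, P f y = h * f x ^ n} := by
  set S := {y : Y | ∃ (x : X) (h : ℂ), ‖h‖ = 1 ∧ ∀ f, P f y = h * f x ^ n}
  rw [isClosed_iff_ultrafilter]
  intro y u huy hS
  obtain ⟨-, x₀, -⟩ := u.nonempty_of_mem hS
  have hex : ∀ z, ∃ (x : X) (h : ℂ), z ∈ S → ‖h‖ = 1 ∧ ∀ f, P f z = h * f x ^ n := by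
    intro z
    by_cases hz : z ∈ S
    · obtain ⟨x, h, hxh⟩ := hz
      exact ⟨x, h, fun _ => hxh⟩
    · exact ⟨x₀, 0, fun h => absurd h hz⟩
  choose ξ η hξη using hex
  obtain ⟨f₀, hf₀⟩ := hreg y
  have hlim : ∀ f, Filter.Tendsto (fun z => P f z) u (nhds (P f y)) := fun f =>
    ((map_continuous (P f)).tendsto y).mono_left huy
  set δ : ℝ := ‖P f₀ y‖ / 2
  have hδ : 0 < δ := half_pos (norm_pos_iff.2 hf₀)
  have hfar : ∀ᶠ z in (u : Filter Y), δ < ‖P f₀ z‖ :=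
    (hlim f₀).norm.eventually (lt_mem_nhds (half_lt_self (norm_pos_iff.2 hf₀)))
  -- The cap at 1 ensures `‖f₀ x‖ ^ n ≤ ‖f₀ x‖` below the threshold, so no `n`-th root of `δ` is
  -- needed.
  have hmin : 0 < min 1 δ := lt_min one_pos hδ
  have hξK : ∀ᶠ z in (u : Filter Y), ξ z ∈ {x | min 1 δ ≤ ‖f₀ x‖} := by
    filter_upwards [hfar, hS] with z hz hzS
    obtain ⟨h1, h2⟩ := hξη z hzS
    rw [h2, norm_mul, h1, one_mul, norm_pow] at hz
    by_contra! hlt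
    have h3 := pow_le_of_le_one (norm_nonneg _) (hlt.le.trans (min_le_left _ _))
      (show n ≠ 0 by omega)
    linarith [min_le_right 1 δ]
  obtain ⟨x, -, hx⟩ := (f₀.isCompact_setOf_le_norm hmin).ultrafilter_le_nhds (u.map ξ)
    (Filter.le_principal_iff.2 hξK)
  have hηK : ∀ᶠ z in (u : Filter Y), η z ∈ Metric.sphere (0 : ℂ) 1 := by
    filter_upwards [hS] with z hz
    rw [mem_sphere_zero_iff_norm]
    exact (hξη z hz).1
  obtain ⟨h, hh, hhη⟩ := (isCompact_sphere (0 : ℂ) 1).ultrafilter_le_nhds (u.map η)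
    (Filter.le_principal_iff.2 hηK)
  refine ⟨x, h, mem_sphere_zero_iff_norm.1 hh, fun f => tendsto_nhds_unique (hlim f) ?_⟩
  have h1 : Filter.Tendsto (fun z => η z * f (ξ z) ^ n) u (nhds (h * f x ^ n)) :=
    Filter.Tendsto.mul hhη ((((map_continuous f).tendsto x).comp hx).pow n)
  refine h1.congr' ?_
  filter_upwards [hS] with z hz
  exact ((hξη z hz).2 f).symm

theorem mainTheorem6 {X Y : Type*}
    [TopologicalSpace X] [LocallyCompactSpace X] [T2Space X]
    [TopologicalSpace Y] [LocallyCompactSpace Y] [T2Space Y]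
    (n : ℕ) (hn : 1 ≤ n) (P : C₀(X, ℂ) → C₀(Y, ℂ))
    (hP : IsHomogeneousPolynomial n P)
    (hadd : IsOrthogonallyAdditive P)
    (hiso : IsNIsometryOnPositive n P)
    (hreg : IsRegularSet (Set.range P)) :
    ∃ (h : Y → ℂ) (φ : Y ≃ₜ X),
      Continuous h ∧ (∀ y : Y, ‖h y‖ = 1) ∧
        ∀ (f : C₀(X, ℂ)) (y : Y), P f y = h y * f (φ y) ^ n := by
  have hn0 : n ≠ 0 := by omega
  have hreg' : ∀ C : Set Y, IsClosed C → ∀ y, y ∉ C → ∃ f, (∀ z ∈ C, P f z = 0) ∧ P f y ≠ 0 := by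
    intro C hC y hy
    obtain ⟨_, ⟨f, rfl⟩, hf⟩ := hreg C hC y hy
    exact ⟨f, hf⟩
  have hpoint := exists_evaluation_point hn P hP
    (fun f g hfg => hadd f g hfg (by rw [mul_comm, hfg])) hiso
  have hclosed := isClosed_setOf_weighted_evaluation hn P fun y => by
    obtain ⟨f, -, hf⟩ := hreg' ∅ isClosed_empty y (Set.notMem_empty y)
    exact ⟨f, hf⟩
  -- If `P f` vanishes on the closed set of evaluation points, then `f` vanishes at every `x`, since
  -- each `x` occurs; so `P f = 0`, against regularity.
  have hall : ∀ y, ∃ (x : X) (h : ℂ), ‖h‖ = 1 ∧ ∀ f, P f y = h * f x ^ n := by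
    intro y
    by_contra hy
    obtain ⟨f, hf0, hfy⟩ := hreg' _ hclosed y hy
    have hf : f = 0 := by
      ext x
      obtain ⟨z, h, hh, hz⟩ := hpoint x
      have := hf0 z ⟨x, h, hh, hz⟩
      rw [hz, mul_eq_zero] at this
      exact (pow_eq_zero_iff hn0).1 (this.resolve_left (norm_pos_iff.1 (by rw [hh]; exact one_pos)))
    have hP0 : P 0 = 0 := by
      have := hadd 0 0 (zero_mul 0) (zero_mul 0)
      rwa [add_zero, left_eq_add] at this
    rw [hf, hP0] at hfy
    exact hfy rfl
  choose φ h hh hφ using hall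
  have hh0 : ∀ y, h y ≠ 0 := fun y => norm_pos_iff.1 (by rw [hh]; exact one_pos)
  have hzero : ∀ f y, P f y = 0 ↔ f (φ y) = 0 := fun f y => by
    rw [hφ, mul_eq_zero, or_iff_right (hh0 y), pow_eq_zero_iff hn0]
  have hinj : Function.Injective φ := by
    intro y z hyz
    by_contra hne
    obtain ⟨f, hf, hfy⟩ := hreg' {z} isClosed_singleton y hne
    have := hf z rfl
    rw [hzero, ← hyz, ← hzero] at this
    exact hfy this
  have hsurj : Function.Surjective φ := by
    intro x
    obtain ⟨y, c, hc, hy⟩ := hpoint x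
    refine ⟨y, ?_⟩
    by_contra hne
    obtain ⟨f, hf1, hf0⟩ := exists_apply_eq_one_of_notMem_isClosed
      (isClosed_singleton (x := φ y)) (x := x) (fun h => hne h.symm)
    have h1 := (hzero f y).2 (hf0 _ rfl)
    rw [hy, hf1, one_pow, mul_one] at h1
    rw [h1, norm_zero] at hc
    exact zero_ne_one hc
  have hcont : Continuous φ := by
    refine continuous_iff_continuousAt.2 fun y U hU => ?_
    obtain ⟨V, hVU, hV, hyV⟩ := mem_nhds_iff.1 hU
    obtain ⟨f, hf1, hf0⟩ := exists_apply_eq_one_of_notMem_isClosed hV.isClosed_compl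
      (x := φ y) (fun h => h hyV)
    have hne : P f y ≠ 0 := fun h => by
      rw [hzero, hf1] at h
      exact one_ne_zero h
    rw [Filter.mem_map]
    filter_upwards [(map_continuous (P f)).continuousAt.eventually_ne hne] with z hz
    refine hVU ?_
    by_contra hzV
    exact hz ((hzero f z).2 (hf0 _ hzV))
  -- Regularity supplies `f` vanishing on `φ '' C` but not at `φ y`, because `P f` and `f ∘ φ` have
  -- the same zeros.
  have hclosedMap : IsClosedMap φ := by
    intro C hC
    rw [← isOpen_compl_iff, isOpen_iff_mem_nhds]
    intro x hx
    obtain ⟨y, rfl⟩ := hsurj x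
    obtain ⟨f, hf, hfy⟩ := hreg' C hC y fun hy => hx ⟨y, hy, rfl⟩
    have hne : f (φ y) ≠ 0 := fun h => hfy ((hzero f y).2 h)
    filter_upwards [(map_continuous f).continuousAt.eventually_ne hne]
    rintro _ hz ⟨z, hzC, rfl⟩
    exact hz ((hzero f z).1 (hf z hzC))
  refine ⟨h, (Equiv.ofBijective φ ⟨hinj, hsurj⟩).toHomeomorphOfContinuousClosed hcont hclosedMap,
    ?_, hh, fun f y => hφ y f⟩
  -- Near `y`, `h` is the quotient of `P f` by `(f ∘ φ) ^ n` for any `f` with `f (φ y) ≠ 0`.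
  refine continuous_iff_continuousAt.2 fun y => ?_
  obtain ⟨f, hf1, -⟩ := exists_apply_eq_one_of_notMem_isClosed isClosed_empty
    (Set.notMem_empty (φ y))
  have hne : f (φ y) ≠ 0 := by rw [hf1]; exact one_ne_zero
  have hfφ : Continuous fun z => f (φ z) := (map_continuous f).comp hcont
  have hquot : ContinuousAt (fun z => P f z / f (φ z) ^ n) y :=
    (map_continuous (P f)).continuousAt.div (hfφ.pow n).continuousAt (pow_ne_zero n hne)
  refine hquot.congr ?_
  filter_upwards [hfφ.continuousAt.eventually_ne hne] with z hz
  rw [hφ z f, mul_div_cancel_right₀ _ (pow_ne_zero n hz)]
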